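/- Let $d<0$ be a squarefree integer with $d\ne-1,-3$, and let $R=\mathcal O_{\mathbb Q(\sqrt d)}\subset\mathbb C$. For $n\ge1$ put $\mathcal L_n=\{x\in R: x\overline x=n\}$, $\mathcal L=\{0\}\cup\mathcal L_1\cup\mathcal L_2\cup\mathcal L_3\cup\mathcal L_4$ and $\mathcal L'=\{0\}\cup\mathcal L_1\cup\mathcal L_2$. An $\mathcal L$-graph $G$ is given by a Hermitian $n\times n$ matrix $A$ with entries in $\mathcal L$ and diagonal entries (the charges of the vertices) in $\{0,1,-1\}$; distinct vertices $i,j$ are joined by an edge when $A_{ij}\ne0$, and the weight of this edge is the norm $A_{ij}\overline{A_{ij}}$. It is an $\mathcal L'$-graph if all entries of $A$ lie in $\mathcal L'$. $G$ is cyclotomic if the spectral radius of $A$ is at most $2$. With $\chi_A(x)=\det(xI-A)$ and $R_A(z)=z^n\chi_A(z+1/z)$, the Mahler measure of $G$ is $M(G)=\prod_{R_A(\alpha)=0}\max(1,|\alpha|)$, roots being counted with multiplicity. Let $G$ be a connected noncyclotomic $\mathcal L$-graph. Then: 1. if $G$ has an edge of weight $4$, then $M(G)\ge 2.08$, and in particular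 $M(G)>1.3$; 2. if $G$ has an edge of weight $3$, then $M(G)\ge 1.556$, and in particular $M(G)>1.3$; 3. consequently, if $M(G)\le1.3$, then $G$ is an $\mathcal L'$-graph. -/

import Mathlib

open Polynomial
open scoped NumberField ComplexConjugate

noncomputable section

namespace LGraphs

/-- The imaginary quadratic field `ℚ(√d)` inside `ℂ`, for an integer `d < 0`
(here `√d = √(-d) · i`). -/
def quadField (d : ℤ) : IntermediateField ℚ ℂ :=
  IntermediateField.adjoin ℚ {((Real.sqrt (-(d : ℝ)) : ℝ) : ℂ) * Complex.I}

/-- The ring of integers of `ℚ(√d)`, as a subring of `ℂ`. -/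
def quadInt (d : ℤ) : Subring ℂ :=
  (algebraMap (𝓞 (quadField d)) ℂ).range

theorem mem_quadInt_iff (d : ℤ) (x : ℂ) :
    x ∈ quadInt d ↔ x ∈ quadField d ∧ IsIntegral ℤ x := by
  constructor
  · rintro ⟨y, rfl⟩
    refine ⟨(y : quadField d).2, ?_⟩
    exact (NumberField.RingOfIntegers.isIntegral_coe y).map
      ((quadField d).val.restrictScalars ℤ)
  · rintro ⟨hx, hi⟩
    have h : IsIntegral ℤ (⟨x, hx⟩ : quadField d) :=
      (isIntegral_algHom_iff ((quadField d).val.restrictScalars ℤ)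
        (quadField d).val.injective).1 hi
    exact ⟨⟨⟨x, hx⟩, h⟩, rfl⟩

/-- The elements of `𝓞 ℚ(√d)` of norm `n`. -/
def labelsOfNorm (d : ℤ) (n : ℕ) : Set ℂ :=
  {x | x ∈ quadInt d ∧ x * conj x = (n : ℂ)}

/-- The label set `𝓛 = {0} ∪ 𝓛₁ ∪ 𝓛₂ ∪ 𝓛₃ ∪ 𝓛₄`. -/
def labels (d : ℤ) : Set ℂ :=
  {0} ∪ labelsOfNorm d 1 ∪ labelsOfNorm d 2 ∪ labelsOfNorm d 3 ∪ labelsOfNorm d 4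

/-- The label set `𝓛' = {0} ∪ 𝓛₁ ∪ 𝓛₂`. -/
def labels' (d : ℤ) : Set ℂ :=
  {0} ∪ labelsOfNorm d 1 ∪ labelsOfNorm d 2

/-- For a polynomial `g` of degree `n`, the polynomial `zⁿ g(z + 1/z)`,
written out as `∑ₖ gₖ zⁿ⁻ᵏ (z² + 1)ᵏ`. -/
def associatedReciprocal (g : ℂ[X]) : ℂ[X] :=
  g.sum fun k a => C a * X ^ (g.natDegree - k) * (X ^ 2 + 1) ^ k

theorem eval_associatedReciprocal (g : ℂ[X]) {z : ℂ} (hz : z ≠ 0) :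
    (associatedReciprocal g).eval z = z ^ g.natDegree * g.eval (z + z⁻¹) := by
  rw [associatedReciprocal, Polynomial.sum_def, eval_finsetSum, eval_eq_sum,
    Polynomial.sum_def, Finset.mul_sum]
  refine Finset.sum_congr rfl fun k hk => ?_
  have hkn : k ≤ g.natDegree := le_natDegree_of_mem_supp k hk
  have h1 : z ^ 2 + 1 = z * (z + z⁻¹) := by field_simp
  have h2 : z ^ g.natDegree = z ^ (g.natDegree - k) * z ^ k := by
    rw [← pow_add, Nat.sub_add_cancel hkn]
  simp only [eval_mul, eval_C, eval_pow, eval_X, eval_add, eval_one]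
  rw [h1, h2, mul_pow]
  ring

/-- An `𝓛`-graph over `𝓞 ℚ(√d)` on the vertex set `V`, given by its Hermitian `𝓛`-matrix:
the diagonal entries are the charges of the vertices (`0` neutral, `1` positive, `-1` negative),
and a nonzero entry at `i ≠ j` is the label of an edge from `i` to `j`. -/
structure LGraph (d : ℤ) (V : Type*) where
  /-- The Hermitian matrix of labels and charges. -/
  matrix : Matrix V V ℂ
  isHermitian : matrix.IsHermitian
  mem_labels : ∀ i j, matrix i j ∈ labels d
  charge : ∀ i, matrix i i = 0 ∨ matrix i i = 1 ∨ matrix i i = -1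

namespace LGraph

variable {d : ℤ} {V : Type*}

/-- The underlying simple graph: distinct `i`, `j` are joined when the entry is nonzero. -/
def toSimpleGraph (G : LGraph d V) : SimpleGraph V where
  Adj i j := i ≠ j ∧ G.matrix i j ≠ 0
  symm := ⟨fun i j h => ⟨h.1.symm, fun h0 => h.2 (by
    rw [← G.isHermitian.apply i j, h0, star_zero])⟩⟩
  loopless := ⟨fun _ h => h.1 rfl⟩

/-- `G` is connected. -/
def Connected (G : LGraph d V) : Prop := G.toSimpleGraph.Connected

/-- `G` has an edge of weight `n`, i.e. an edge whose label has norm `n`. -/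
def HasEdgeOfWeight (G : LGraph d V) (n : ℕ) : Prop :=
  ∃ i j, G.toSimpleGraph.Adj i j ∧ G.matrix i j ∈ labelsOfNorm d n

/-- `G` is an `𝓛'`-graph: all its labels and charges lie in `𝓛'`. -/
def IsLPrimeGraph (G : LGraph d V) : Prop := ∀ i j, G.matrix i j ∈ labels' d

variable [Fintype V] [DecidableEq V]

/-- `G` is cyclotomic: its matrix has spectral radius at most `2`. -/
def IsCyclotomic (G : LGraph d V) : Prop := spectralRadius ℂ G.matrix ≤ 2

/-- The Mahler measure of `G`: that of the associated reciprocal polynomial of the characteristic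
polynomial of its matrix. -/
def mahlerMeasure (G : LGraph d V) : ℝ :=
  (associatedReciprocal G.matrix.charpoly).mahlerMeasure

end LGraph

end LGraphs

end

/-!
The eigenvalues of the Hermitian matrix `A` of `G` are real, and an eigenvalue `λ` with `|λ| > 2`
contributes to the Mahler measure the root `z` of modulus greater than `1` with `z + 1/z = λ`. Hence
`M(G) ≥ α` as soon as some eigenvalue has modulus at least `α + 1/α`, and `M(G) ≥ αβ` if there are
eigenvalues `≥ α + 1/α` and `≤ -(β + 1/β)` (`le_mahlerMeasure_of_hasEigenvalueGE`,
`mul_le_mahlerMeasure`). If all eigenvalues were less than `x`, then `x - A` would be positive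
definite; so an eigenvalue `≥ x` is detected by a single principal minor of `x - A` that is not
positive (`hasEigenvalueGE_of_det_le`). Only minors of order at most four are needed. Their
coefficients are the weights, the charges, and twice the real parts of the products of the labels
around triangles and `4`-cycles; the latter are traces from the ring of integers, hence rational
integers (`exists_int_eq_two_mul_re`).

Suppose `M(G)` is smaller than the claimed bound and grow `G` from an edge of weight four or three.

* An edge of weight four must have neutral ends and no neighbour
  (`apply_eq_zero_of_normSq_eq_four`). So it is all of `G`, which then is cyclotomic.
* An edge of weight three whose ends are not both neutral must have ends of charges `1` and `-1`
  and no neighbour (`apply_eq_zero_of_charged`); again `G` is cyclotomic.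
* A neighbour of a neutral edge `i - j` of weight three must be neutral and joined to exactly one of
  its ends, by an edge of weight one (`neighbor_of_neutral`). Each end has at most one such neighbour
  (`false_of_star`), this neighbour has no neighbour outside
  (`apply_eq_zero_of_path`), and if both ends have one then the four vertices form a `4`-cycle of
  edge weights `3, 1, 3, 1` around which the product of the labels is `-3` (`cycle_of_neighbors`).
  So `G` is the edge, a path on three vertices, or this `4`-cycle, with `A² = 3`, `A³ = 4A`, `A² = 4`
  respectively, and is cyclotomic (`isCyclotomic_of_neighbor`).
-/

namespace LGraphs

open scoped ComplexOrder

/-! ### Real eigenvalues and the Mahler measure -/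

theorem isRoot_associatedReciprocal {g : ℂ[X]} {z : ℂ} (hz : z ≠ 0) (h : g.IsRoot (z + z⁻¹)) :
    (associatedReciprocal g).IsRoot z := by
  rw [IsRoot, eval_associatedReciprocal g hz, h.eq_zero, mul_zero]

theorem associatedReciprocal_monic {g : ℂ[X]} (hg : g.Monic) : (associatedReciprocal g).Monic := by
  have hX : (X ^ 2 + 1 : ℂ[X]).Monic := by monicity!
  have hXd : (X ^ 2 + 1 : ℂ[X]).degree = 2 := by compute_degree!
  have hXn : (X ^ 2 + 1 : ℂ[X]).natDegree = 2 := by compute_degree!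
  have hn : g.natDegree ∈ g.support := natDegree_mem_support_of_nonzero hg.ne_zero
  rw [associatedReciprocal, Polynomial.sum_def, ← Finset.add_sum_erase _ _ hn,
    hg.coeff_natDegree]
  simp only [map_one, Nat.sub_self, pow_zero, one_mul]
  -- the `k`-th summand has degree at most `n + k`, so the one with `k = n` dominates
  refine (hX.pow _).add_of_left ?_
  have hd : ((X ^ 2 + 1 : ℂ[X]) ^ g.natDegree).degree = ((2 * g.natDegree : ℕ) : WithBot ℕ) := by
    rw [degree_eq_natDegree (hX.pow _).ne_zero, hX.natDegree_pow, hXn, mul_comm]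
  rw [hd]
  refine (degree_sum_le _ _).trans_lt ((Finset.sup_lt_iff (WithBot.bot_lt_coe _)).2 fun k hk => ?_)
  obtain ⟨hk1, hk2⟩ := Finset.mem_erase.1 hk
  have hkn : k < g.natDegree := lt_of_le_of_ne (le_natDegree_of_mem_supp k hk2) hk1
  refine degree_le_natDegree.trans_lt (WithBot.coe_lt_coe.2 ?_)
  calc _ ≤ (C (g.coeff k) * X ^ (g.natDegree - k)).natDegree
          + ((X ^ 2 + 1 : ℂ[X]) ^ k).natDegree := natDegree_mul_le
    _ ≤ (g.natDegree - k) + k * 2 := by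
        rw [hX.natDegree_pow, hXn]
        gcongr
        exact natDegree_C_mul_X_pow_le _ _
    _ < 2 * g.natDegree := by omega

theorem one_le_prod_max_one_norm (s : Multiset ℂ) : 1 ≤ (s.map fun z => max 1 ‖z‖).prod := by
  refine Multiset.one_le_prod fun x hx => ?_
  obtain ⟨z, -, rfl⟩ := Multiset.mem_map.1 hx
  exact le_max_left _ _

theorem norm_le_prod_max_one_norm {s : Multiset ℂ} {x : ℂ} (hx : x ∈ s) :
    ‖x‖ ≤ (s.map fun z => max 1 ‖z‖).prod := by
  obtain ⟨t, rfl⟩ := Multiset.exists_cons_of_mem hx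
  rw [Multiset.map_cons, Multiset.prod_cons]
  exact (le_max_right _ _).trans
    (le_mul_of_one_le_right (by positivity) (one_le_prod_max_one_norm t))

theorem norm_mul_norm_le_prod_max_one_norm {s : Multiset ℂ} {x y : ℂ} (hx : x ∈ s) (hy : y ∈ s)
    (hxy : x ≠ y) : ‖x‖ * ‖y‖ ≤ (s.map fun z => max 1 ‖z‖).prod := by
  obtain ⟨t, rfl⟩ := Multiset.exists_cons_of_mem hx
  rw [Multiset.map_cons, Multiset.prod_cons]
  exact mul_le_mul (le_max_right _ _) (norm_le_prod_max_one_norm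
    ((Multiset.mem_cons.1 hy).resolve_left hxy.symm)) (norm_nonneg y) (by positivity)

/-- Every real number `t ≥ α + 1/α` with `α ≥ 1` is `z + 1/z` for some real `z ≥ α`. -/
theorem exists_add_inv_eq {α t : ℝ} (hα : 1 ≤ α) (ht : α + α⁻¹ ≤ t) :
    ∃ z : ℝ, α ≤ z ∧ z + z⁻¹ = t := by
  have h0 : 0 < α := by linarith
  have hi : 0 < α⁻¹ := by positivity
  have hm : α * α⁻¹ = 1 := mul_inv_cancel₀ h0.ne'
  have hi1 : α⁻¹ ≤ α := by nlinarith
  have hs : (α - α⁻¹) ^ 2 ≤ t ^ 2 - 4 := by nlinarith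
  have hsq : 0 ≤ t ^ 2 - 4 := (sq_nonneg _).trans hs
  have h1 : α - α⁻¹ ≤ √(t ^ 2 - 4) := Real.le_sqrt_of_sq_le hs
  refine ⟨(t + √(t ^ 2 - 4)) / 2, by linarith, ?_⟩
  have hne : t + √(t ^ 2 - 4) ≠ 0 := by
    have := Real.sqrt_nonneg (t ^ 2 - 4)
    linarith
  have hss := Real.sq_sqrt hsq
  field_simp
  nlinarith

variable {V : Type*} [Fintype V] [DecidableEq V]

/-- `A` has a real eigenvalue that is at least `x`. Applied to `-A`, this says that `A` has
a real eigenvalue that is at most `-x`. -/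
def HasEigenvalueGE (A : Matrix V V ℂ) (x : ℝ) : Prop :=
  ∃ t : ℝ, x ≤ t ∧ A.charpoly.IsRoot (t : ℂ)

theorem isRoot_charpoly_neg {A : Matrix V V ℂ} {t : ℂ} (h : (-A).charpoly.IsRoot t) :
    A.charpoly.IsRoot (-t) := by
  rw [IsRoot, Matrix.eval_charpoly] at h ⊢
  have : Matrix.scalar V (-t) - A = -(Matrix.scalar V t - -A) := by
    rw [map_neg]; abel
  rw [this, Matrix.det_neg, h, mul_zero]

theorem HasEigenvalueGE.exists_isRoot {A : Matrix V V ℂ} {α : ℝ} (hα : 1 ≤ α)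
    (h : HasEigenvalueGE A (α + α⁻¹)) :
    ∃ z : ℝ, α ≤ z ∧ (associatedReciprocal A.charpoly).IsRoot (z : ℂ) := by
  obtain ⟨t, ht, htr⟩ := h
  obtain ⟨z, hz, rfl⟩ := exists_add_inv_eq hα ht
  have hz0 : z ≠ 0 := by linarith
  exact ⟨z, hz, isRoot_associatedReciprocal (by exact_mod_cast hz0) (by simpa using htr)⟩

theorem HasEigenvalueGE.exists_isRoot_neg {A : Matrix V V ℂ} {α : ℝ} (hα : 1 ≤ α)
    (h : HasEigenvalueGE (-A) (α + α⁻¹)) :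
    ∃ z : ℝ, α ≤ z ∧ (associatedReciprocal A.charpoly).IsRoot (-z : ℂ) := by
  obtain ⟨t, ht, htr⟩ := h
  obtain ⟨z, hz, rfl⟩ := exists_add_inv_eq hα ht
  have hz0 : (z : ℂ) ≠ 0 := by exact_mod_cast (by linarith : z ≠ 0)
  refine ⟨z, hz, isRoot_associatedReciprocal (neg_ne_zero.2 hz0) ?_⟩
  have := isRoot_charpoly_neg htr
  rwa [show (-((z + z⁻¹ : ℝ) : ℂ)) = -z + (-z : ℂ)⁻¹ by push_cast; rw [inv_neg]; ring] at this

theorem prod_roots_le_mahlerMeasure (A : Matrix V V ℂ) :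
    ((associatedReciprocal A.charpoly).roots.map fun z => max 1 ‖z‖).prod ≤
      (associatedReciprocal A.charpoly).mahlerMeasure :=
  prod_max_one_norm_roots_le_mahlerMeasure_of_one_le_leadingCoeff (by
    rw [(associatedReciprocal_monic A.charpoly_monic).leadingCoeff, norm_one])

theorem le_mahlerMeasure_of_hasEigenvalueGE {A : Matrix V V ℂ} {α : ℝ} (hα : 1 ≤ α)
    (h : HasEigenvalueGE A (α + α⁻¹) ∨ HasEigenvalueGE (-A) (α + α⁻¹)) :
    α ≤ (associatedReciprocal A.charpoly).mahlerMeasure := by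
  have hmon := associatedReciprocal_monic A.charpoly_monic
  refine le_trans ?_ (prod_roots_le_mahlerMeasure A)
  rcases h with h | h
  · obtain ⟨z, hz, h1⟩ := h.exists_isRoot hα
    refine le_trans ?_ (norm_le_prod_max_one_norm ((mem_roots hmon.ne_zero).2 h1))
    rwa [Complex.norm_of_nonneg (by linarith)]
  · obtain ⟨z, hz, h1⟩ := h.exists_isRoot_neg hα
    refine le_trans ?_ (norm_le_prod_max_one_norm ((mem_roots hmon.ne_zero).2 h1))
    rwa [norm_neg, Complex.norm_of_nonneg (by linarith)]

theorem mul_le_mahlerMeasure {A : Matrix V V ℂ} {α β : ℝ} (hα : 1 ≤ α) (hβ : 1 ≤ β)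
    (h : HasEigenvalueGE A (α + α⁻¹)) (h' : HasEigenvalueGE (-A) (β + β⁻¹)) :
    α * β ≤ (associatedReciprocal A.charpoly).mahlerMeasure := by
  have hmon := associatedReciprocal_monic A.charpoly_monic
  obtain ⟨z, hz, h1⟩ := h.exists_isRoot hα
  obtain ⟨w, hw, h2⟩ := h'.exists_isRoot_neg hβ
  have hne : (z : ℂ) ≠ -w := by
    intro h
    have : z = -w := by exact_mod_cast h
    linarith
  refine le_trans ?_ (prod_roots_le_mahlerMeasure A)
  refine le_trans ?_ (norm_mul_norm_le_prod_max_one_norm ((mem_roots hmon.ne_zero).2 h1)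
    ((mem_roots hmon.ne_zero).2 h2) hne)
  rw [norm_neg, Complex.norm_of_nonneg (by linarith), Complex.norm_of_nonneg (by linarith)]
  exact mul_le_mul hz hw (by linarith) (by linarith)

/-- If all eigenvalues of a Hermitian matrix `A` were below `x`, then `x - A` would be positive
definite, and so would its principal submatrices; their determinants would be positive. -/
theorem hasEigenvalueGE_of_det_le {A : Matrix V V ℂ} (hA : A.IsHermitian) {m : Type*} [Fintype m]
    [DecidableEq m] {e : m → V} (he : Function.Injective e) {x : ℝ}
    (h : (Matrix.of fun s t => (if s = t then (x : ℂ) else 0) - A (e s) (e t)).det.re ≤ 0) :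
    HasEigenvalueGE A x := by
  by_contra hcon
  have hcon' : ∀ t : ℝ, A.charpoly.IsRoot (t : ℂ) → t < x := fun t ht => by
    by_contra hx
    exact hcon ⟨t, not_lt.1 hx, ht⟩
  have hB : (Matrix.scalar V (x : ℂ) - A).IsHermitian :=
    Matrix.IsHermitian.sub (Matrix.isHermitian_diagonal_of_self_adjoint _ (by
      ext i; simp)) hA
  have hpos : (Matrix.scalar V (x : ℂ) - A).PosDef := by
    rw [hB.posDef_iff_eigenvalues_pos]
    intro i
    have hr : (Matrix.scalar V (x : ℂ) - A).charpoly.IsRoot (hB.eigenvalues i : ℂ) := by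
      rw [hB.charpoly_eq, IsRoot, eval_prod]
      exact Finset.prod_eq_zero (Finset.mem_univ i) (by simp)
    have : A.charpoly.IsRoot ((x - hB.eigenvalues i : ℝ) : ℂ) := by
      rw [IsRoot, Matrix.eval_charpoly] at hr ⊢
      rw [show Matrix.scalar V ((x - hB.eigenvalues i : ℝ) : ℂ) - A =
          -(Matrix.scalar V (hB.eigenvalues i : ℂ) - (Matrix.scalar V (x : ℂ) - A)) by
        rw [Complex.ofReal_sub, map_sub]; abel, Matrix.det_neg, hr, mul_zero]
    linarith [hcon' _ this]
  have hsub := (hpos.submatrix he).det_pos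
  rw [show (Matrix.scalar V (x : ℂ) - A).submatrix e e =
      Matrix.of fun s t => (if s = t then (x : ℂ) else 0) - A (e s) (e t) by
    ext i j; simp [Matrix.diagonal_apply, he.eq_iff]] at hsub
  have := (Complex.lt_def.1 hsub).1
  simp only [Complex.zero_re] at this
  linarith

/-! ### Principal minors of order two, three and four -/

theorem hasEigenvalueGE_of_minor_two {A : Matrix V V ℂ} (hA : A.IsHermitian) {i j : V}
    (hij : i ≠ j) {a b : ℝ} (ha : A i i = a) (hb : A j j = b) {x : ℝ}
    (h : (x - a) * (x - b) - Complex.normSq (A i j) ≤ 0) : HasEigenvalueGE A x := by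
  refine hasEigenvalueGE_of_det_le hA (e := ![i, j]) ?_ (le_of_eq_of_le ?_ h)
  · intro s t
    fin_cases s <;> fin_cases t <;> simp [hij, hij.symm]
  · rw [Matrix.det_fin_two]
    simp [ha, hb, ← hA.apply j i, Complex.normSq_apply]

theorem hasEigenvalueGE_of_minor_three {A : Matrix V V ℂ} (hA : A.IsHermitian) {i j k : V}
    (hij : i ≠ j) (hik : i ≠ k) (hjk : j ≠ k) {a b c : ℝ} (ha : A i i = a) (hb : A j j = b)
    (hc : A k k = c) {x : ℝ}
    (h : (x - a) * (x - b) * (x - c) - Complex.normSq (A i j) * (x - c)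
      - Complex.normSq (A i k) * (x - b) - Complex.normSq (A j k) * (x - a)
      - 2 * (A i j * A j k * A k i).re ≤ 0) : HasEigenvalueGE A x := by
  refine hasEigenvalueGE_of_det_le hA (e := ![i, j, k]) ?_ (le_of_eq_of_le ?_ h)
  · intro s t
    fin_cases s <;> fin_cases t <;> simp [hij, hij.symm, hik, hik.symm, hjk, hjk.symm]
  · rw [Matrix.det_fin_three]
    simp [ha, hb, hc, ← hA.apply j i, ← hA.apply k i, ← hA.apply k j, Complex.normSq_apply]
    ring

/-- The characteristic polynomial of a Hermitian matrix of order four on `j - i - k` and a further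
vertex `l`, where `i`, `j`, `k` have charge zero and `j`, `k` are not joined. -/
theorem hasEigenvalueGE_of_minor_four {A : Matrix V V ℂ} (hA : A.IsHermitian) {i j k l : V}
    (hij : i ≠ j) (hik : i ≠ k) (hil : i ≠ l) (hjk : j ≠ k) (hjl : j ≠ l) (hkl : k ≠ l)
    (hi : A i i = 0) (hj : A j j = 0) (hk : A k k = 0) {c : ℝ} (hc : A l l = c)
    (h0 : A j k = 0) {x : ℝ}
    (h : x ^ 3 * (x - c) - (Complex.normSq (A i j) + Complex.normSq (A i k)) * x * (x - c)
      - (Complex.normSq (A i l) + Complex.normSq (A j l) + Complex.normSq (A k l)) * x ^ 2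
      + Complex.normSq (A i j) * Complex.normSq (A k l)
      + Complex.normSq (A i k) * Complex.normSq (A j l)
      - 2 * (A i j * A j l * A l i).re * x - 2 * (A i k * A k l * A l i).re * x
      - 2 * (A i j * A j l * A l k * A k i).re ≤ 0) : HasEigenvalueGE A x := by
  refine hasEigenvalueGE_of_det_le hA (e := ![i, j, k, l]) ?_ (le_of_eq_of_le ?_ h)
  · intro s t
    fin_cases s <;> fin_cases t <;>
      simp [hij, hij.symm, hik, hik.symm, hjk, hjk.symm, hil, hil.symm, hjl, hjl.symm, hkl,
        hkl.symm]
  · have h0' : A k j = 0 := by rw [← hA.apply k j, h0, star_zero]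
    rw [show (Matrix.of fun s t => (if s = t then (x : ℂ) else 0)
        - A (![i, j, k, l] s) (![i, j, k, l] t)) =
        !![(x : ℂ), -A i j, -A i k, -A i l; -conj (A i j), x, 0, -A j l;
          -conj (A i k), 0, x, -A k l; -conj (A i l), -conj (A j l), -conj (A k l), x - c] by
      ext s t
      fin_cases s <;> fin_cases t <;> simp [hi, hj, hk, hc, h0, h0', ← hA.apply j i,
        ← hA.apply k i, ← hA.apply l i, ← hA.apply l j, ← hA.apply l k]]
    rw [← hA.apply k i, ← hA.apply l i, ← hA.apply l k, Matrix.det_succ_row_zero]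
    generalize A i j = u, A i k = v, A i l = w, A j l = y, A k l = z
    simp [Fin.sum_univ_succ, Matrix.det_fin_three, Fin.succAbove, Complex.normSq_apply,
      show (-1 : ℂ) ^ 3 = -1 by norm_num]
    ring

theorem hasEigenvalueGE_neg_of_minor_two {A : Matrix V V ℂ} (hA : A.IsHermitian) {i j : V}
    (hij : i ≠ j) {a b : ℝ} (ha : A i i = a) (hb : A j j = b) {x : ℝ}
    (h : (x + a) * (x + b) - Complex.normSq (A i j) ≤ 0) : HasEigenvalueGE (-A) x :=
  hasEigenvalueGE_of_minor_two hA.neg hij (a := -a) (b := -b) (by simp [ha]) (by simp [hb])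
    (by simpa [Complex.normSq_neg] using h)

theorem hasEigenvalueGE_neg_of_minor_three {A : Matrix V V ℂ} (hA : A.IsHermitian) {i j k : V}
    (hij : i ≠ j) (hik : i ≠ k) (hjk : j ≠ k) {a b c : ℝ} (ha : A i i = a) (hb : A j j = b)
    (hc : A k k = c) {x : ℝ}
    (h : (x + a) * (x + b) * (x + c) - Complex.normSq (A i j) * (x + c)
      - Complex.normSq (A i k) * (x + b) - Complex.normSq (A j k) * (x + a)
      + 2 * (A i j * A j k * A k i).re ≤ 0) : HasEigenvalueGE (-A) x := by
  refine hasEigenvalueGE_of_minor_three hA.neg hij hik hjk (a := -a) (b := -b) (c := -c)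
    (by simp [ha]) (by simp [hb]) (by simp [hc]) (le_of_eq_of_le ?_ h)
  simp only [Matrix.neg_apply, Complex.normSq_neg]
  rw [show -A i j * -A j k * -A k i = -(A i j * A j k * A k i) by ring, Complex.neg_re]
  ring

theorem hasEigenvalueGE_neg_of_minor_four {A : Matrix V V ℂ} (hA : A.IsHermitian) {i j k l : V}
    (hij : i ≠ j) (hik : i ≠ k) (hil : i ≠ l) (hjk : j ≠ k) (hjl : j ≠ l) (hkl : k ≠ l)
    (hi : A i i = 0) (hj : A j j = 0) (hk : A k k = 0) {c : ℝ} (hc : A l l = c)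
    (h0 : A j k = 0) {x : ℝ}
    (h : x ^ 3 * (x + c) - (Complex.normSq (A i j) + Complex.normSq (A i k)) * x * (x + c)
      - (Complex.normSq (A i l) + Complex.normSq (A j l) + Complex.normSq (A k l)) * x ^ 2
      + Complex.normSq (A i j) * Complex.normSq (A k l)
      + Complex.normSq (A i k) * Complex.normSq (A j l)
      + 2 * (A i j * A j l * A l i).re * x + 2 * (A i k * A k l * A l i).re * x
      - 2 * (A i j * A j l * A l k * A k i).re ≤ 0) : HasEigenvalueGE (-A) x := by
  refine hasEigenvalueGE_of_minor_four hA.neg hij hik hil hjk hjl hkl (c := -c)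
    (by simp [hi]) (by simp [hj]) (by simp [hk]) (by simp [hc]) (by simp [h0])
    (le_of_eq_of_le ?_ h)
  simp only [Matrix.neg_apply, Complex.normSq_neg]
  rw [show -A i j * -A j l * -A l i = -(A i j * A j l * A l i) by ring,
    show -A i k * -A k l * -A l i = -(A i k * A k l * A l i) by ring,
    show -A i j * -A j l * -A l k * -A k i = A i j * A j l * A l k * A k i by ring,
    Complex.neg_re, Complex.neg_re]
  ring

end LGraphs

namespace LGraphs

/-! ### Traces of elements of the ring of integers -/

/-- The elements of `ℚ(√d)` have the form `a + b√d` with rational `a` and `b`. -/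
theorem exists_rat_of_mem_quadField {d : ℤ} (hd : d < 0) {x : ℂ} (hx : x ∈ quadField d) :
    ∃ a b : ℚ, x = a + b * (((Real.sqrt (-(d : ℝ)) : ℝ) : ℂ) * Complex.I) := by
  set ω : ℂ := ((Real.sqrt (-(d : ℝ)) : ℝ) : ℂ) * Complex.I with hω
  have hω2 : ω * ω = d := by
    have h0 : (0 : ℝ) ≤ -(d : ℝ) := by
      have : (d : ℝ) < 0 := by exact_mod_cast hd
      linarith
    have h1 : ((Real.sqrt (-(d : ℝ)) : ℝ) : ℂ) * ((Real.sqrt (-(d : ℝ)) : ℝ) : ℂ) = -d := by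
      rw [← Complex.ofReal_mul, Real.mul_self_sqrt h0]; simp
    rw [hω, mul_mul_mul_comm, h1, Complex.I_mul_I]; ring
  have hωc : conj ω = -ω := by simp [hω]
  induction hx using IntermediateField.adjoin_induction with
  | mem x hx => exact ⟨0, 1, by simpa using hx⟩
  | algebraMap q => exact ⟨q, 0, by simp⟩
  | add x y _ _ hx hy =>
    obtain ⟨a, b, rfl⟩ := hx
    obtain ⟨a', b', rfl⟩ := hy
    exact ⟨a + a', b + b', by push_cast; ring⟩
  | mul x y _ _ hx hy =>
    obtain ⟨a, b, rfl⟩ := hx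
    obtain ⟨a', b', rfl⟩ := hy
    exact ⟨a * a' + b * b' * d, a * b' + a' * b, by push_cast; rw [← hω2]; ring⟩
  | inv x _ hx =>
    obtain ⟨a, b, rfl⟩ := hx
    have hN : (a + b * ω) * conj (a + b * ω) = ((a * a - b * b * d : ℚ) : ℂ) := by
      rw [map_add, map_mul, hωc]
      push_cast
      rw [← hω2]
      simp only [map_ratCast]
      ring
    have hinv : (a + b * ω)⁻¹ = conj (a + b * ω) * ((a * a - b * b * d : ℚ) : ℂ)⁻¹ := by
      rw [Complex.inv_def, ← hN, Complex.mul_conj, Complex.ofReal_inv]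
    refine ⟨a * (a * a - b * b * d)⁻¹, -b * (a * a - b * b * d)⁻¹, ?_⟩
    rw [hinv, map_add, map_mul, hωc]
    simp only [map_ratCast]
    push_cast
    ring

/-- The trace `2 Re x` of an element of the ring of integers is rational and integral over `ℤ`. -/
theorem exists_int_eq_two_mul_re {d : ℤ} (hd : d < 0) {x : ℂ} (hx : x ∈ quadInt d) :
    ∃ t : ℤ, 2 * x.re = t := by
  obtain ⟨hx1, hx2⟩ := (mem_quadInt_iff d x).1 hx
  obtain ⟨a, b, hab⟩ := exists_rat_of_mem_quadField hd hx1
  have hre : x.re = a := by rw [hab]; simp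
  have hint : IsIntegral ℤ (x + conj x) := hx2.add (hx2.map (starRingEnd ℂ).toIntAlgHom)
  rw [Complex.add_conj, hre,
    show ((2 * (a : ℝ) : ℝ) : ℂ) = algebraMap ℚ ℂ (2 * a) by simp] at hint
  have hq : IsIntegral ℤ (2 * a) :=
    (isIntegral_algHom_iff ((Algebra.ofId ℚ ℂ).restrictScalars ℤ)
      (algebraMap ℚ ℂ).injective).1 hint
  obtain ⟨t, ht⟩ := IsIntegrallyClosed.isIntegral_iff.1 hq
  refine ⟨t, ?_⟩
  rw [hre]
  have : ((t : ℚ) : ℝ) = ((2 * a : ℚ) : ℝ) := by rw [← ht]; simp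
  push_cast at this
  exact this.symm

namespace LGraph

/-! ### Labels, weights and charges -/

variable {d : ℤ} {V : Type*} (G : LGraph d V)

theorem apply_mem_quadInt (i j : V) : G.matrix i j ∈ quadInt d := by
  rcases G.mem_labels i j with (((h | h) | h) | h) | h
  · rw [Set.mem_singleton_iff.1 h]; exact zero_mem _
  all_goals exact h.1

theorem exists_charge (i : V) :
    ∃ c : ℝ, G.matrix i i = c ∧ (c = 0 ∨ c = 1 ∨ c = -1) := by
  rcases G.charge i with h | h | h
  · exact ⟨0, by simp [h]⟩
  · exact ⟨1, by simp [h]⟩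
  · exact ⟨-1, by simp [h]⟩

theorem normSq_of_mem_labelsOfNorm {x : ℂ} {n : ℕ} (h : x ∈ labelsOfNorm d n) :
    Complex.normSq x = n := by
  have := h.2
  rw [Complex.mul_conj] at this
  exact_mod_cast this

theorem exists_normSq_eq (i j : V) : ∃ m : ℕ, Complex.normSq (G.matrix i j) = m ∧ m ≤ 4 := by
  rcases G.mem_labels i j with (((h | h) | h) | h) | h
  · exact ⟨0, by simp [Set.mem_singleton_iff.1 h]⟩
  · exact ⟨1, normSq_of_mem_labelsOfNorm h, by norm_num⟩
  · exact ⟨2, normSq_of_mem_labelsOfNorm h, by norm_num⟩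
  · exact ⟨3, normSq_of_mem_labelsOfNorm h, by norm_num⟩
  · exact ⟨4, normSq_of_mem_labelsOfNorm h, by norm_num⟩

theorem apply_comm (i j : V) : G.matrix i j = conj (G.matrix j i) :=
  (G.isHermitian.apply i j).symm

theorem normSq_comm (i j : V) :
    Complex.normSq (G.matrix i j) = Complex.normSq (G.matrix j i) := by
  rw [G.apply_comm, Complex.normSq_conj]

theorem apply_eq_zero_comm {i j : V} (h : G.matrix i j = 0) : G.matrix j i = 0 := by
  rw [G.apply_comm, h, map_zero]

variable {G}

theorem isLPrimeGraph_of_not_hasEdgeOfWeight (h3 : ¬ G.HasEdgeOfWeight 3)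
    (h4 : ¬ G.HasEdgeOfWeight 4) : G.IsLPrimeGraph := by
  -- a label of norm at least two is not a charge, so it sits on an edge
  have key : ∀ i j, ∀ n : ℕ, 2 ≤ n → G.matrix i j ∈ labelsOfNorm d n → G.HasEdgeOfWeight n := by
    intro i j n hn h
    have hns := normSq_of_mem_labelsOfNorm h
    have hn' : (2 : ℝ) ≤ n := by exact_mod_cast hn
    refine ⟨i, j, ⟨?_, ?_⟩, h⟩
    · rintro rfl
      rcases G.charge i with hc | hc | hc <;> rw [hc] at hns <;> simp at hns <;> linarith
    · intro h0
      rw [h0, map_zero] at hns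
      linarith
  intro i j
  rcases G.mem_labels i j with h | h
  · rcases h with h | h
    · exact h
    · exact (h3 (key i j 3 (by norm_num) h)).elim
  · exact (h4 (key i j 4 (by norm_num) h)).elim

/-! ### Cyclotomic graphs on at most four vertices -/

/-- A nonempty set of vertices with no edge leaving it is the whole of a connected graph. -/
theorem forall_mem_of_closed (hconn : G.Connected) {S : Set V} {x : V} (hx : x ∈ S)
    (h : ∀ a ∈ S, ∀ b ∉ S, G.matrix a b = 0) (y : V) : y ∈ S := by
  obtain ⟨p⟩ := hconn.preconnected x y
  induction p with
  | nil => exact hx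
  | cons hadj p ih =>
    refine ih ?_
    by_contra hb
    exact hadj.2 (h _ hx _ hb)

variable [Fintype V] [DecidableEq V]

/-- A noncyclotomic graph has an eigenvalue `k` with `|k| > 2`; the form in which this is used is
that `k²` is not a real number in `[0, 4]`. -/
theorem exists_eigenvector_of_not_isCyclotomic (hG : ¬ G.IsCyclotomic) :
    ∃ k : ℂ, (∀ s : ℝ, 0 ≤ s → s ≤ 4 → k ^ 2 - s ≠ 0) ∧
      ∃ v : V → ℂ, v ≠ 0 ∧ G.matrix.mulVec v = k • v := by
  rw [IsCyclotomic, spectralRadius, iSup₂_le_iff] at hG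
  push Not at hG
  obtain ⟨k, hk, hk2⟩ := hG
  have hk2' : 2 < ‖k‖ := by
    have : (2 : NNReal) < ‖k‖₊ := by exact_mod_cast hk2
    exact_mod_cast this
  rw [spectrum.mem_iff, Matrix.isUnit_iff_isUnit_det, isUnit_iff_ne_zero, not_not,
    ← Matrix.exists_mulVec_eq_zero_iff] at hk
  obtain ⟨v, hv, hkv⟩ := hk
  refine ⟨k, ?_, v, hv, ?_⟩
  · intro s hs hs4 h
    have : ‖k‖ ^ 2 = s := by rw [← norm_pow, sub_eq_zero.1 h, Complex.norm_of_nonneg hs]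
    nlinarith
  · rw [Matrix.sub_mulVec, sub_eq_zero, Algebra.algebraMap_eq_smul_one, Matrix.smul_mulVec,
      Matrix.one_mulVec] at hkv
    exact hkv.symm

/-- A graph on two vertices with opposite charges `a`, `-a` satisfies `A² = s`, where `s` is the sum
of `a²` and the weight of its edge. -/
theorem isCyclotomic_of_two {i j : V} (hij : i ≠ j) (huniv : ∀ y, y = i ∨ y = j)
    {a : ℝ} (hi : G.matrix i i = a) (hj : G.matrix j j = -a)
    (hn : a ^ 2 + Complex.normSq (G.matrix i j) ≤ 4) : G.IsCyclotomic := by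
  by_contra hG
  obtain ⟨k, hk, v, hv, hkv⟩ := exists_eigenvector_of_not_isCyclotomic hG
  have hu : (Finset.univ : Finset V) = {i, j} := by
    ext y; simpa using huniv y
  have hs : ∀ x, G.matrix x i * v i + G.matrix x j * v j = k * v x := fun x => by
    have := congrFun hkv x
    simpa [Matrix.mulVec, dotProduct, hu, Finset.sum_pair hij] using this
  have h1 := hs i
  have h2 := hs j
  have hk4 := hk _ (add_nonneg (sq_nonneg a) (Complex.normSq_nonneg _)) hn
  have hn' : (a : ℂ) ^ 2 + G.matrix i j * G.matrix j i =
      ((a ^ 2 + Complex.normSq (G.matrix i j) : ℝ) : ℂ) := by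
    rw [G.apply_comm j i, Complex.mul_conj]
    push_cast
    rfl
  generalize ((a ^ 2 + Complex.normSq (G.matrix i j) : ℝ) : ℂ) = s at hk4 hn'
  rw [hi] at h1
  rw [hj] at h2
  have e1 : (k ^ 2 - s) * v i = 0 := by
    linear_combination (-(k : ℂ) - a) * h1 - G.matrix i j * h2 + v i * hn'
  have e2 : (k ^ 2 - s) * v j = 0 := by
    linear_combination (-(k : ℂ) + a) * h2 - G.matrix j i * h1 + v j * hn'
  apply hv
  funext y
  rcases huniv y with rfl | rfl
  · exact (mul_eq_zero.1 e1).resolve_left hk4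
  · exact (mul_eq_zero.1 e2).resolve_left hk4

/-- A neutral path on three vertices with edge weights `n` and `4 - n` satisfies `A³ = 4A`. -/
theorem isCyclotomic_of_three {i j k : V} (hij : i ≠ j) (hik : i ≠ k) (hjk : j ≠ k)
    (huniv : ∀ y, y = i ∨ y = j ∨ y = k) (hi : G.matrix i i = 0) (hj : G.matrix j j = 0)
    (hk : G.matrix k k = 0) (h0 : G.matrix j k = 0)
    (hn : Complex.normSq (G.matrix i j) + Complex.normSq (G.matrix i k) = 4) :
    G.IsCyclotomic := by
  by_contra hG
  obtain ⟨t, ht, v, hv, htv⟩ := exists_eigenvector_of_not_isCyclotomic hG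
  have ht0 : t ≠ 0 := by simpa using ht 0 le_rfl (by norm_num)
  have ht4 : t ^ 2 - 4 ≠ 0 := by simpa using ht 4 (by norm_num) le_rfl
  have hu : (Finset.univ : Finset V) = {i, j, k} := by
    ext y; simpa using huniv y
  have hs : ∀ x, G.matrix x i * v i + (G.matrix x j * v j + G.matrix x k * v k) = t * v x :=
    fun x => by
    have := congrFun htv x
    simpa [Matrix.mulVec, dotProduct, hu, Finset.sum_insert, hij, hik, hjk] using this
  have h1 := hs i
  have h2 := hs j
  have h3 := hs k
  rw [hi] at h1
  rw [hj, h0] at h2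
  rw [hk, G.apply_eq_zero_comm h0] at h3
  have hn' : G.matrix i j * G.matrix j i + G.matrix i k * G.matrix k i = 4 := by
    rw [G.apply_comm j i, G.apply_comm k i, Complex.mul_conj, Complex.mul_conj]
    exact_mod_cast hn
  have e1 : (t ^ 2 - 4) * v i = 0 := by
    linear_combination -t * h1 - G.matrix i j * h2 - G.matrix i k * h3 + v i * hn'
  have e1' := (mul_eq_zero.1 e1).resolve_left ht4
  have e2 : t * v j = 0 := by rw [← h2, e1']; ring
  have e3 : t * v k = 0 := by rw [← h3, e1']; ring
  apply hv
  funext y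
  rcases huniv y with rfl | rfl | rfl
  · exact e1'
  · exact (mul_eq_zero.1 e2).resolve_left ht0
  · exact (mul_eq_zero.1 e3).resolve_left ht0

/-- The hypothesis says that `|xy + zw|² = 0`. -/
theorem mul_add_mul_eq_zero {x y z w : ℂ} (h : Complex.normSq (x * y) + Complex.normSq (z * w)
    + 2 * (x * y * conj w * conj z).re = 0) : x * y + z * w = 0 := by
  rw [← Complex.normSq_eq_zero, Complex.normSq_add, map_mul (starRingEnd ℂ), ← h]
  ring_nf

/-- A neutral `4`-cycle with alternating edge weights `3, 1, 3, 1`, around which the product of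
the labels is `-3`, satisfies `A² = 4`. -/
theorem isCyclotomic_of_four {i j k l : V} (hij : i ≠ j) (hik : i ≠ k) (hil : i ≠ l) (hjk : j ≠ k)
    (hjl : j ≠ l) (hkl : k ≠ l) (huniv : ∀ y, y = i ∨ y = j ∨ y = k ∨ y = l)
    (hi : G.matrix i i = 0) (hj : G.matrix j j = 0)
    (hk : G.matrix k k = 0) (hl : G.matrix l l = 0) (h0 : G.matrix j k = 0) (h0' : G.matrix i l = 0)
    (n1 : Complex.normSq (G.matrix i j) = 3) (n2 : Complex.normSq (G.matrix i k) = 1)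
    (n3 : Complex.normSq (G.matrix j l) = 1) (n4 : Complex.normSq (G.matrix k l) = 3)
    (hR : 2 * (G.matrix i j * G.matrix j l * G.matrix l k * G.matrix k i).re = -6) :
    G.IsCyclotomic := by
  by_contra hG
  obtain ⟨t, ht, v, hv, htv⟩ := exists_eigenvector_of_not_isCyclotomic hG
  have ht4 : t ^ 2 - 4 ≠ 0 := by simpa using ht 4 (by norm_num) le_rfl
  have hu : (Finset.univ : Finset V) = {i, j, k, l} := by
    ext y; simpa using huniv y
  have hs : ∀ x, G.matrix x i * v i + (G.matrix x j * v j + (G.matrix x k * v k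
      + G.matrix x l * v l)) = t * v x := fun x => by
    have := congrFun htv x
    simpa [Matrix.mulVec, dotProduct, hu, Finset.sum_insert, hij, hik, hjk, hil, hjl, hkl] using this
  have h1 := hs i
  have h2 := hs j
  have h3 := hs k
  have h4 := hs l
  rw [hi, h0'] at h1
  rw [hj, h0] at h2
  rw [hk, G.apply_eq_zero_comm h0] at h3
  rw [hl, G.apply_eq_zero_comm h0'] at h4
  have m1 : G.matrix i j * G.matrix j i = 3 := by
    rw [G.apply_comm j i, Complex.mul_conj, n1]; norm_num
  have m2 : G.matrix i k * G.matrix k i = 1 := by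
    rw [G.apply_comm k i, Complex.mul_conj, n2]; norm_num
  have m3 : G.matrix j l * G.matrix l j = 1 := by
    rw [G.apply_comm l j, Complex.mul_conj, n3]; norm_num
  have m4 : G.matrix k l * G.matrix l k = 3 := by
    rw [G.apply_comm l k, Complex.mul_conj, n4]; norm_num
  -- the two off-diagonal entries of `A²` that may fail to vanish
  have z1 : G.matrix i j * G.matrix j l + G.matrix i k * G.matrix k l = 0 := by
    apply mul_add_mul_eq_zero
    rw [← G.apply_comm, ← G.apply_comm, hR, map_mul, map_mul, n1, n2, n3, n4]
    norm_num
  have z2 : G.matrix j i * G.matrix i k + G.matrix j l * G.matrix l k = 0 := by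
    apply mul_add_mul_eq_zero
    have : G.matrix j i * G.matrix i k * conj (G.matrix l k) * conj (G.matrix j l)
        = conj (G.matrix i j * G.matrix j l * G.matrix l k * G.matrix k i) := by
      simp only [map_mul]
      rw [← G.apply_comm j i, ← G.apply_comm i k]
      ring
    rw [this, Complex.conj_re, hR, map_mul, map_mul, G.normSq_comm j i, G.normSq_comm l k, n1, n2,
      n3, n4]
    norm_num
  have z1' : G.matrix l j * G.matrix j i + G.matrix l k * G.matrix k i = 0 := by
    have := congrArg conj z1
    simp only [map_add, map_mul, map_zero, ← G.apply_comm] at this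
    linear_combination this
  have z2' : G.matrix k i * G.matrix i j + G.matrix k l * G.matrix l j = 0 := by
    have := congrArg conj z2
    simp only [map_add, map_mul, map_zero, ← G.apply_comm] at this
    linear_combination this
  have e1 : (t ^ 2 - 4) * v i = 0 := by
    linear_combination -t * h1 - G.matrix i j * h2 - G.matrix i k * h3 + v i * m1 + v i * m2
      + v l * z1
  have e2 : (t ^ 2 - 4) * v j = 0 := by
    linear_combination -t * h2 - G.matrix j i * h1 - G.matrix j l * h4 + v j * m1 + v j * m3
      + v k * z2
  have e3 : (t ^ 2 - 4) * v k = 0 := by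
    linear_combination -t * h3 - G.matrix k i * h1 - G.matrix k l * h4 + v k * m2 + v k * m4
      + v j * z2'
  have e4 : (t ^ 2 - 4) * v l = 0 := by
    linear_combination -t * h4 - G.matrix l j * h2 - G.matrix l k * h3 + v l * m3 + v l * m4
      + v i * z1'
  apply hv
  funext y
  rcases huniv y with rfl | rfl | rfl | rfl
  · exact (mul_eq_zero.1 e1).resolve_left ht4
  · exact (mul_eq_zero.1 e2).resolve_left ht4
  · exact (mul_eq_zero.1 e3).resolve_left ht4
  · exact (mul_eq_zero.1 e4).resolve_left ht4

end LGraph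

/-! ### Growing an edge of weight four -/

theorem two_mul_re_sq_le (z : ℂ) : (2 * z.re) ^ 2 ≤ 4 * Complex.normSq z := by
  have := Complex.re_sq_le_normSq z
  rw [mul_pow, pow_two z.re]
  nlinarith

namespace LGraph

variable {d : ℤ} {V : Type*} [Fintype V] [DecidableEq V] {G : LGraph d V}

theorem not_hasEigenvalueGE {α : ℝ} (hα : 1 ≤ α) (hM : G.mahlerMeasure < α) :
    ¬ HasEigenvalueGE G.matrix (α + α⁻¹) ∧ ¬ HasEigenvalueGE (-G.matrix) (α + α⁻¹) := by
  rw [← not_or]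
  exact fun h => (le_mahlerMeasure_of_hasEigenvalueGE hα h).not_gt hM

/-- An eigenvalue above `2` and another one below `-2` contribute a product to the Mahler measure. -/
theorem false_of_hasEigenvalueGE_of_neg {α β : ℝ} (hα : 1 ≤ α) (hβ : 1 ≤ β)
    (hM : G.mahlerMeasure < α * β) (h : HasEigenvalueGE G.matrix (α + α⁻¹))
    (h' : HasEigenvalueGE (-G.matrix) (β + β⁻¹)) : False :=
  (mul_le_mahlerMeasure hα hβ h h').not_gt hM

/-- An edge of weight four with charged ends has the eigenvalues `±√5` if the charges are opposite,
and an eigenvalue of modulus at least `(1 + √17) / 2` otherwise. -/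
theorem charge_eq_zero_of_normSq_eq_four (hM : G.mahlerMeasure < 2.08) {i j : V} (hij : i ≠ j)
    (hn : Complex.normSq (G.matrix i j) = 4) : G.matrix i i = 0 ∧ G.matrix j j = 0 := by
  obtain ⟨a, ha, ha'⟩ := G.exists_charge i
  obtain ⟨b, hb, hb'⟩ := G.exists_charge j
  obtain ⟨h1, h2⟩ := not_hasEigenvalueGE (by norm_num) hM
  have h1' := mt (hasEigenvalueGE_of_minor_two G.isHermitian hij ha hb) h1
  have h2' := mt (hasEigenvalueGE_neg_of_minor_two G.isHermitian hij ha hb) h2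
  -- `1.45² ≥ 2.08`: both a large and a small eigenvalue are excluded
  have h3 := fun h h' => false_of_hasEigenvalueGE_of_neg (α := 1.45) (β := 1.45) (by norm_num)
    (by norm_num) (hM.trans (by norm_num))
    (hasEigenvalueGE_of_minor_two G.isHermitian hij ha hb h)
    (hasEigenvalueGE_neg_of_minor_two G.isHermitian hij ha hb h')
  rw [hn] at h1' h2' h3
  rw [ha, hb]
  rcases ha' with rfl | rfl | rfl <;> rcases hb' with rfl | rfl | rfl <;>
    first
    | (norm_num; done)
    | (norm_num at h1'; done)
    | (norm_num at h2'; done)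
    | norm_num at h3

/-- In a graph of small Mahler measure, an edge of weight four has no neighbour. -/
theorem apply_eq_zero_of_normSq_eq_four (hd : d < 0) (hM : G.mahlerMeasure < 2.08) {i j k : V}
    (hij : i ≠ j) (hik : i ≠ k) (hjk : j ≠ k)
    (hn : Complex.normSq (G.matrix i j) = 4) : G.matrix i k = 0 ∧ G.matrix j k = 0 := by
  obtain ⟨ha, hb⟩ := charge_eq_zero_of_normSq_eq_four hM hij hn
  replace ha : G.matrix i i = ((0 : ℝ) : ℂ) := by simp [ha]
  replace hb : G.matrix j j = ((0 : ℝ) : ℂ) := by simp [hb]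
  obtain ⟨c, hc, hc'⟩ := G.exists_charge k
  obtain ⟨p, hp, hp4⟩ := G.exists_normSq_eq i k
  obtain ⟨q, hq, hq4⟩ := G.exists_normSq_eq j k
  obtain ⟨t, ht⟩ := exists_int_eq_two_mul_re hd (mul_mem (mul_mem (G.apply_mem_quadInt i j)
    (G.apply_mem_quadInt j k)) (G.apply_mem_quadInt k i))
  obtain ⟨h1, h2⟩ := not_hasEigenvalueGE (by norm_num) hM
  have h1' := mt (hasEigenvalueGE_of_minor_three G.isHermitian hij hik hjk ha hb hc) h1
  have h2' := mt (hasEigenvalueGE_neg_of_minor_three G.isHermitian hij hik hjk ha hb hc) h2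
  have h3 := fun h h' => false_of_hasEigenvalueGE_of_neg (α := 1.45) (β := 1.45) (by norm_num)
    (by norm_num) (hM.trans (by norm_num))
    (hasEigenvalueGE_of_minor_three G.isHermitian hij hik hjk ha hb hc h)
    (hasEigenvalueGE_neg_of_minor_three G.isHermitian hij hik hjk ha hb hc h')
  have hR := two_mul_re_sq_le (G.matrix i j * G.matrix j k * G.matrix k i)
  rw [map_mul, map_mul, hn, G.normSq_comm k i, hp, hq, ht] at hR
  rw [hn, hp, hq, ht, not_le] at h1' h2'
  rw [hn, hp, hq, ht] at h3
  -- adding the two inequalities eliminates the charge and the triangle term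
  have hpq : (p : ℝ) + q < 3 := by
    norm_num at h1' h2'
    nlinarith
  have hpq' : p + q < 3 := by exact_mod_cast hpq
  rw [← Complex.normSq_eq_zero (z := G.matrix i k), ← Complex.normSq_eq_zero (z := G.matrix j k),
    hp, hq]
  have ht0 : p * q = 0 → t = 0 := by
    intro h0
    have : (p : ℝ) * q = 0 := by exact_mod_cast h0
    have : (t : ℝ) ^ 2 ≤ 0 := by nlinarith
    have : (t : ℝ) = 0 := by nlinarith
    exact_mod_cast this
  obtain ⟨rfl, rfl⟩ | ⟨rfl, rfl⟩ | h0 : (p = 0 ∧ q = 0) ∨ (p = 1 ∧ q = 1) ∨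
      (p * q = 0 ∧ 1 ≤ p + q) := by
    interval_cases p <;> interval_cases q <;> simp_all
  · simp
  · exfalso
    -- integrality of the triangle term excludes the range between `-4` and `-3`
    have t1 : -3 ≤ t := by
      by_contra hlt
      have : (t : ℝ) ≤ -4 := by exact_mod_cast (by omega : t ≤ -4)
      rcases hc' with rfl | rfl | rfl <;> norm_num at h1' h2' <;> linarith
    have t2 : t ≤ 3 := by
      by_contra hlt
      have : (4 : ℝ) ≤ t := by exact_mod_cast (by omega : 4 ≤ t)
      rcases hc' with rfl | rfl | rfl <;> norm_num at h1' h2' <;> linarith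
    have t1' : (-3 : ℝ) ≤ t := by exact_mod_cast t1
    have t2' : (t : ℝ) ≤ 3 := by exact_mod_cast t2
    refine h3 ?_ ?_ <;> rcases hc' with rfl | rfl | rfl <;> norm_num at h1' h2' ⊢ <;> linarith
  · exfalso
    rw [ht0 h0.1] at h3
    have h1 : (1 : ℝ) ≤ p + q := by exact_mod_cast h0.2
    refine h3 ?_ ?_ <;> rcases hc' with rfl | rfl | rfl <;> norm_num at h1' h2' ⊢ <;> linarith

theorem le_mahlerMeasure_of_hasEdgeOfWeight_four (hd : d < 0) (hconn : G.Connected)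
    (hG : ¬ G.IsCyclotomic) (h : G.HasEdgeOfWeight 4) : 2.08 ≤ G.mahlerMeasure := by
  obtain ⟨i, j, hadj, hw⟩ := h
  have hn : Complex.normSq (G.matrix i j) = 4 := by
    simpa using normSq_of_mem_labelsOfNorm hw
  by_contra hM
  rw [not_le] at hM
  obtain ⟨ha, hb⟩ := charge_eq_zero_of_normSq_eq_four hM hadj.1 hn
  refine hG (isCyclotomic_of_two hadj.1 (a := 0) (fun y => ?_) (by simp [ha]) (by simp [hb])
    (by simp [hn]))
  refine forall_mem_of_closed hconn (S := {i, j}) (Set.mem_insert i _) ?_ y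
  rintro a ha' b hb'
  simp only [Set.mem_insert_iff, Set.mem_singleton_iff, not_or] at ha' hb'
  have := apply_eq_zero_of_normSq_eq_four hd hM hadj.1 (Ne.symm hb'.1) (Ne.symm hb'.2) hn
  rcases ha' with rfl | rfl
  · exact this.1
  · exact this.2

/-! ### Growing an edge of weight three -/

/-- The ends of an edge of weight three are both neutral or oppositely charged: any other charges
give an eigenvalue of modulus at least `(1 + √13) / 2`. -/
theorem charge_of_normSq_eq_three (hM : G.mahlerMeasure < 1.556) {i j : V} (hij : i ≠ j)
    (hn : Complex.normSq (G.matrix i j) = 3) :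
    (G.matrix i i = 0 ∧ G.matrix j j = 0) ∨ (G.matrix i i = 1 ∧ G.matrix j j = -1) ∨
      (G.matrix i i = -1 ∧ G.matrix j j = 1) := by
  obtain ⟨a, ha, ha'⟩ := G.exists_charge i
  obtain ⟨b, hb, hb'⟩ := G.exists_charge j
  obtain ⟨h1, h2⟩ := not_hasEigenvalueGE (by norm_num) hM
  have h1' := mt (hasEigenvalueGE_of_minor_two G.isHermitian hij ha hb) h1
  have h2' := mt (hasEigenvalueGE_neg_of_minor_two G.isHermitian hij ha hb) h2
  rw [hn] at h1' h2'
  rw [ha, hb]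
  rcases ha' with rfl | rfl | rfl <;> rcases hb' with rfl | rfl | rfl <;>
    first
    | (norm_num; done)
    | (norm_num at h1'; done)
    | norm_num at h2'

/-- In a graph of small Mahler measure, an edge of weight three with oppositely charged ends has no
neighbour. -/
theorem apply_eq_zero_of_charged (hM : G.mahlerMeasure < 1.556) {i j k : V}
    (hij : i ≠ j) (hik : i ≠ k) (hjk : j ≠ k) (hn : Complex.normSq (G.matrix i j) = 3)
    (hi : G.matrix i i = 1) (hj : G.matrix j j = -1) : G.matrix i k = 0 ∧ G.matrix j k = 0 := by
  have ha : G.matrix i i = ((1 : ℝ) : ℂ) := by simp [hi]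
  have hb : G.matrix j j = ((-1 : ℝ) : ℂ) := by simp [hj]
  obtain ⟨c, hc, hc'⟩ := G.exists_charge k
  obtain ⟨p, hp, -⟩ := G.exists_normSq_eq i k
  obtain ⟨q, hq, -⟩ := G.exists_normSq_eq j k
  obtain ⟨h1, h2⟩ := not_hasEigenvalueGE (by norm_num) hM
  have h1' := mt (hasEigenvalueGE_of_minor_three G.isHermitian hij hik hjk ha hb hc) h1
  have h2' := mt (hasEigenvalueGE_neg_of_minor_three G.isHermitian hij hik hjk ha hb hc) h2
  rw [hn, hp, hq, not_le] at h1' h2'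
  -- the sum of the two inequalities
  have hpq : (p : ℝ) + q < 1 := by
    norm_num at h1' h2'
    linarith
  have hpq' : p + q < 1 := by exact_mod_cast hpq
  rw [← Complex.normSq_eq_zero (z := G.matrix i k), ← Complex.normSq_eq_zero (z := G.matrix j k),
    hp, hq]
  constructor <;> norm_cast <;> omega

/-- In a graph of small Mahler measure, a neighbour of a neutral edge of weight three is neutral
and hangs on it by a single edge of weight one. -/
theorem neighbor_of_neutral (hM : G.mahlerMeasure < 1.556) {i j k : V}
    (hij : i ≠ j) (hik : i ≠ k) (hjk : j ≠ k) (hn : Complex.normSq (G.matrix i j) = 3)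
    (hi : G.matrix i i = 0) (hj : G.matrix j j = 0) :
    (G.matrix i k = 0 ∧ G.matrix j k = 0) ∨
    (G.matrix k k = 0 ∧ Complex.normSq (G.matrix i k) = 1 ∧ G.matrix j k = 0) ∨
    (G.matrix k k = 0 ∧ G.matrix i k = 0 ∧ Complex.normSq (G.matrix j k) = 1) := by
  have ha : G.matrix i i = ((0 : ℝ) : ℂ) := by simp [hi]
  have hb : G.matrix j j = ((0 : ℝ) : ℂ) := by simp [hj]
  obtain ⟨c, hc, hc'⟩ := G.exists_charge k
  obtain ⟨p, hp, -⟩ := G.exists_normSq_eq i k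
  obtain ⟨q, hq, -⟩ := G.exists_normSq_eq j k
  obtain ⟨h1, h2⟩ := not_hasEigenvalueGE (by norm_num) hM
  have h1' := mt (hasEigenvalueGE_of_minor_three G.isHermitian hij hik hjk ha hb hc) h1
  have h2' := mt (hasEigenvalueGE_neg_of_minor_three G.isHermitian hij hik hjk ha hb hc) h2
  have hR := two_mul_re_sq_le (G.matrix i j * G.matrix j k * G.matrix k i)
  rw [map_mul, map_mul, hn, G.normSq_comm k i, hp, hq] at hR
  rw [hn, hp, hq, not_le] at h1' h2'
  generalize 2 * (G.matrix i j * G.matrix j k * G.matrix k i).re = r at h1' h2' hR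
  -- the sum of the two inequalities
  have hpq : (p : ℝ) + q < 2 := by
    norm_num at h1' h2'
    linarith
  have hpq' : p + q < 2 := by exact_mod_cast hpq
  have hc0 : p + q = 1 → c = 0 := by
    intro h
    have hpq0 : (p : ℝ) * q = 0 := by
      have : p * q = 0 := by
        obtain rfl | rfl : p = 0 ∨ q = 0 := by omega
        · simp
        · simp
      exact_mod_cast this
    have hr0 : r = 0 := by nlinarith
    have h' : (p : ℝ) + q = 1 := by exact_mod_cast h
    rw [hr0] at h1' h2'
    -- a charged neighbour: here `x³ - x² - 4x + 3`, whose largest root `2.1987` is just above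
    -- `1.556 + 1/1.556`, is the extremal case
    rcases hc' with rfl | rfl | rfl
    · rfl
    · norm_num at h1'
      linarith
    · norm_num at h2'
      linarith
  rw [← Complex.normSq_eq_zero (z := G.matrix i k), ← Complex.normSq_eq_zero (z := G.matrix j k),
    hp, hq, hc]
  norm_cast
  rcases Nat.eq_zero_or_pos (p + q) with h | h
  · exact Or.inl (by omega)
  · have hc00 := hc0 (by omega)
    obtain h | h : (p = 1 ∧ q = 0) ∨ (p = 0 ∧ q = 1) := by omega
    · exact Or.inr (Or.inl ⟨hc00, h⟩)
    · exact Or.inr (Or.inr ⟨hc00, h⟩)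

section FourthVertex

variable {i j k l : V} (hM : G.mahlerMeasure < 1.556) (hij : i ≠ j) (hik : i ≠ k) (hil : i ≠ l)
  (hjk : j ≠ k) (hjl : j ≠ l) (hkl : k ≠ l) (n1 : Complex.normSq (G.matrix i j) = 3)
  (n2 : Complex.normSq (G.matrix i k) = 1) (hi : G.matrix i i = 0) (hj : G.matrix j j = 0)
  (hk : G.matrix k k = 0) (h0 : G.matrix j k = 0)
include hM hij hik hil hjk hjl hkl n1 n2 hi hj hk h0

/-- In a graph of small Mahler measure, an end of a neutral edge of weight three has at most one
further neighbour. -/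
theorem false_of_star (hl : G.matrix l l = 0) (n3 : Complex.normSq (G.matrix i l) = 1)
    (h0' : G.matrix j l = 0) : False := by
  have hc : G.matrix l l = ((0 : ℝ) : ℂ) := by simp [hl]
  obtain ⟨h1, h2⟩ := not_hasEigenvalueGE (by norm_num) hM
  have h1' := mt (hasEigenvalueGE_of_minor_four G.isHermitian hij hik hil hjk hjl hkl hi hj hk hc
    h0) h1
  have h2' := mt (hasEigenvalueGE_neg_of_minor_four G.isHermitian hij hik hil hjk hjl hkl hi hj hk
    hc h0) h2
  have hm := Complex.normSq_nonneg (G.matrix k l)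
  rw [n1, n2, n3, h0', not_le] at h1' h2'
  simp only [mul_zero, zero_mul, map_zero, Complex.zero_re] at h1' h2'
  norm_num at h1' h2'
  linarith

/-- In a graph of small Mahler measure, the path `j - i - k` with edge weights three and one does
not extend beyond `k`. -/
theorem apply_eq_zero_of_path (h1 : G.matrix i l = 0) (h2 : G.matrix j l = 0) :
    G.matrix k l = 0 := by
  obtain ⟨c, hc, hc'⟩ := G.exists_charge l
  obtain ⟨m, hm, -⟩ := G.exists_normSq_eq k l
  have h3 := fun (α β : ℝ) (hα : 1 ≤ α) (hβ : 1 ≤ β) (hαβ : 1.556 ≤ α * β) h h' =>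
    false_of_hasEigenvalueGE_of_neg hα hβ (hM.trans_le hαβ)
    (hasEigenvalueGE_of_minor_four G.isHermitian hij hik hil hjk hjl hkl hi hj hk hc h0 h)
    (hasEigenvalueGE_neg_of_minor_four G.isHermitian hij hik hil hjk hjl hkl hi hj hk hc h0 h')
  rw [n1, n2, hm, h1, h2, G.apply_eq_zero_comm h1] at h3
  simp only [mul_zero, zero_mul, map_zero, Complex.zero_re] at h3
  by_contra hne
  have hm1 : (1 : ℝ) ≤ m := by
    have : m ≠ 0 := by
      rintro rfl
      exact hne (Complex.normSq_eq_zero.1 (by simpa using hm))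
    exact_mod_cast Nat.one_le_iff_ne_zero.2 this
  -- a charge at `l` moves both extreme eigenvalues in the same direction, so that the bound
  -- `1.556` has to be split unevenly between them
  rcases hc' with rfl | rfl | rfl
  · refine h3 1.25 1.25 (by norm_num) (by norm_num) (by norm_num) ?_ ?_ <;> norm_num <;> linarith
  · refine h3 1.3 1.2 (by norm_num) (by norm_num) (by norm_num) ?_ ?_ <;> norm_num <;> linarith
  · refine h3 1.2 1.3 (by norm_num) (by norm_num) (by norm_num) ?_ ?_ <;> norm_num <;> linarith

/-- Two neighbours `k`, `l` at the two ends of a neutral edge of weight three must complete it to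
the cyclotomic `4`-cycle. -/
theorem cycle_of_neighbors (hd : d < 0) (hl : G.matrix l l = 0) (h1 : G.matrix i l = 0)
    (n3 : Complex.normSq (G.matrix j l) = 1) : Complex.normSq (G.matrix k l) = 3 ∧
      2 * (G.matrix i j * G.matrix j l * G.matrix l k * G.matrix k i).re = -6 := by
  have hc : G.matrix l l = ((0 : ℝ) : ℂ) := by simp [hl]
  obtain ⟨m, hm, hm4⟩ := G.exists_normSq_eq k l
  -- `1.25² ≥ 1.556`: since `A l l = A i l = 0`, the spectrum of the four vertices is symmetric about `0`
  have h3 := fun h h' => false_of_hasEigenvalueGE_of_neg (α := 1.25) (β := 1.25)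
    (by norm_num) (by norm_num) (hM.trans (by norm_num))
    (hasEigenvalueGE_of_minor_four G.isHermitian hij hik hil hjk hjl hkl hi hj hk hc h0 h)
    (hasEigenvalueGE_neg_of_minor_four G.isHermitian hij hik hil hjk hjl hkl hi hj hk hc h0 h')
  obtain ⟨t, ht⟩ := exists_int_eq_two_mul_re hd (mul_mem (mul_mem (mul_mem
    (G.apply_mem_quadInt i j) (G.apply_mem_quadInt j l)) (G.apply_mem_quadInt l k))
    (G.apply_mem_quadInt k i))
  have hR := two_mul_re_sq_le (G.matrix i j * G.matrix j l * G.matrix l k * G.matrix k i)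
  rw [map_mul, map_mul, map_mul, n1, n3, G.normSq_comm k i, n2, G.normSq_comm l k, hm, ht] at hR
  rw [n1, n2, hm, n3, ht, h1, G.apply_eq_zero_comm h1] at h3
  simp only [mul_zero, map_zero, Complex.zero_re] at h3
  have hR' : t ^ 2 ≤ 12 * m := by
    have : ((t ^ 2 : ℤ) : ℝ) ≤ ((12 * m : ℤ) : ℝ) := by push_cast; linarith
    exact_mod_cast this
  have hlt : (t : ℝ) < -2.34 - 1.2 * m := by
    by_contra h
    have hm0 : (0 : ℝ) ≤ m := m.cast_nonneg
    refine h3 ?_ ?_ <;> norm_num at h ⊢ <;> linarith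
  have hlt' : 10 * t + 12 * m < -23 := by
    have : ((10 * t + 12 * m : ℤ) : ℝ) < ((-23 : ℤ) : ℝ) := by push_cast; linarith
    exact_mod_cast this
  rw [hm, ht]
  -- the integer `t` satisfies `t² ≤ 12 m` and `10 t < -23 - 12 m`
  have key : m = 3 ∧ t = -6 := by
    interval_cases m <;> norm_num at hR' hlt'
    · have : t ≤ -3 := by omega
      nlinarith
    · have : t ≤ -4 := by omega
      nlinarith
    · have : t ≤ -5 := by omega
      nlinarith
    · have : t ≤ -6 := by omega
      exact ⟨rfl, by nlinarith⟩
    · have : t ≤ -8 := by omega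
      nlinarith
  obtain ⟨rfl, rfl⟩ := key
  norm_num

end FourthVertex

/-- A neutral edge of weight three with a further edge at `i` grows no further than to one of two
cyclotomic graphs: a path on three vertices, or a cycle on four. -/
theorem isCyclotomic_of_neighbor (hd : d < 0) (hconn : G.Connected)
    (hM : G.mahlerMeasure < 1.556) {i j k : V} (hij : i ≠ j) (hik : i ≠ k) (hjk : j ≠ k)
    (n1 : Complex.normSq (G.matrix i j) = 3) (n2 : Complex.normSq (G.matrix i k) = 1)
    (hi : G.matrix i i = 0) (hj : G.matrix j j = 0) (hk : G.matrix k k = 0)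
    (h0 : G.matrix j k = 0) : G.IsCyclotomic := by
  have n1' : Complex.normSq (G.matrix j i) = 3 := by rw [G.normSq_comm, n1]
  by_cases hl : ∃ l, i ≠ l ∧ j ≠ l ∧ k ≠ l ∧ G.matrix j l ≠ 0
  · obtain ⟨l, hil, hjl, hkl, hne⟩ := hl
    obtain ⟨-, h⟩ | ⟨-, -, h⟩ | ⟨hl0, h1, n3⟩ := neighbor_of_neutral hM hij hil hjl n1 hi hj
    · exact absurd h hne
    · exact absurd h hne
    obtain ⟨n4, hR⟩ := cycle_of_neighbors hM hij hik hil hjk hjl hkl n1 n2 hi hj hk h0 hd hl0 h1 n3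
    refine isCyclotomic_of_four hij hik hil hjk hjl hkl (fun y => ?_) hi hj hk hl0 h0 h1 n1 n2 n3
      n4 hR
    refine forall_mem_of_closed hconn (S := {i, j, k, l}) (Set.mem_insert i _) ?_ y
    intro a ha m hm
    simp only [Set.mem_insert_iff, Set.mem_singleton_iff, not_or] at ha hm
    obtain ⟨him, hjm, hkm, hlm⟩ := hm
    have hboth : G.matrix i m = 0 ∧ G.matrix j m = 0 := by
      obtain h | ⟨hm0, h2, h3⟩ | ⟨hm0, h2, h3⟩ :=
        neighbor_of_neutral hM hij (Ne.symm him) (Ne.symm hjm) n1 hi hj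
      · exact h
      · exact (false_of_star hM hij hik (Ne.symm him) hjk (Ne.symm hjm) (Ne.symm hkm) n1 n2 hi hj
          hk h0 hm0 h2 h3).elim
      · exact (false_of_star hM hij.symm hjl (Ne.symm hjm) hil (Ne.symm him) (Ne.symm hlm) n1' n3
          hj hi hl0 h1 hm0 h3 h2).elim
    rcases ha with rfl | rfl | rfl | rfl
    · exact hboth.1
    · exact hboth.2
    · exact apply_eq_zero_of_path hM hij hik (Ne.symm him) hjk (Ne.symm hjm) (Ne.symm hkm) n1 n2 hi
        hj hk h0 hboth.1 hboth.2
    · exact apply_eq_zero_of_path hM hij.symm hjl (Ne.symm hjm) hil (Ne.symm him) (Ne.symm hlm) n1'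
        n3 hj hi hl0 h1 hboth.2 hboth.1
  · push Not at hl
    refine isCyclotomic_of_three hij hik hjk (fun y => ?_) hi hj hk h0 (by rw [n1, n2]; norm_num)
    refine forall_mem_of_closed hconn (S := {i, j, k}) (Set.mem_insert i _) ?_ y
    intro a ha m hm
    simp only [Set.mem_insert_iff, Set.mem_singleton_iff, not_or] at ha hm
    obtain ⟨him, hjm, hkm⟩ := hm
    have hj0 := hl m (Ne.symm him) (Ne.symm hjm) (Ne.symm hkm)
    have hi0 : G.matrix i m = 0 := by
      obtain h | ⟨hm0, h2, h3⟩ | ⟨-, h2, -⟩ :=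
        neighbor_of_neutral hM hij (Ne.symm him) (Ne.symm hjm) n1 hi hj
      · exact h.1
      · exact (false_of_star hM hij hik (Ne.symm him) hjk (Ne.symm hjm) (Ne.symm hkm) n1 n2 hi hj
          hk h0 hm0 h2 h3).elim
      · exact h2
    rcases ha with rfl | rfl | rfl
    · exact hi0
    · exact hj0
    · exact apply_eq_zero_of_path hM hij hik (Ne.symm him) hjk (Ne.symm hjm) (Ne.symm hkm) n1 n2 hi
        hj hk h0 hi0 hj0

/-- A charged edge of weight three does not grow at all. -/
theorem isCyclotomic_of_charged (hconn : G.Connected) (hM : G.mahlerMeasure < 1.556) {i j : V}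
    (hij : i ≠ j) (hn : Complex.normSq (G.matrix i j) = 3) (hi : G.matrix i i = 1)
    (hj : G.matrix j j = -1) : G.IsCyclotomic := by
  refine isCyclotomic_of_two hij (a := 1) (fun y => ?_) (by simp [hi]) (by simp [hj])
    (by rw [hn]; norm_num)
  refine forall_mem_of_closed hconn (S := {i, j}) (Set.mem_insert i _) ?_ y
  rintro a ha b hb
  simp only [Set.mem_insert_iff, Set.mem_singleton_iff, not_or] at ha hb
  have := apply_eq_zero_of_charged hM hij (Ne.symm hb.1) (Ne.symm hb.2) hn hi hj
  rcases ha with rfl | rfl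
  · exact this.1
  · exact this.2

theorem isCyclotomic_of_neutral (hd : d < 0) (hconn : G.Connected) (hM : G.mahlerMeasure < 1.556)
    {i j : V} (hij : i ≠ j) (hn : Complex.normSq (G.matrix i j) = 3) (hi : G.matrix i i = 0)
    (hj : G.matrix j j = 0) : G.IsCyclotomic := by
  have hn' : Complex.normSq (G.matrix j i) = 3 := by rw [G.normSq_comm, hn]
  by_contra hG
  refine hG (isCyclotomic_of_two hij (a := 0) (fun y => ?_) (by simp [hi]) (by simp [hj])
    (by rw [hn]; norm_num))
  refine forall_mem_of_closed hconn (S := {i, j}) (Set.mem_insert i _) ?_ y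
  rintro a ha k hk
  simp only [Set.mem_insert_iff, Set.mem_singleton_iff, not_or] at ha hk
  have hik := Ne.symm hk.1
  have hjk := Ne.symm hk.2
  have h : G.matrix i k = 0 ∧ G.matrix j k = 0 := by
    obtain h | ⟨hk0, h1, h2⟩ | ⟨hk0, h1, h2⟩ := neighbor_of_neutral hM hij hik hjk hn hi hj
    · exact h
    · exact (hG (isCyclotomic_of_neighbor hd hconn hM hij hik hjk hn h1 hi hj hk0 h2)).elim
    · exact (hG (isCyclotomic_of_neighbor hd hconn hM hij.symm hjk hik hn' h2 hj hi hk0 h1)).elim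
  rcases ha with rfl | rfl
  · exact h.1
  · exact h.2

theorem le_mahlerMeasure_of_hasEdgeOfWeight_three (hd : d < 0) (hconn : G.Connected)
    (hG : ¬ G.IsCyclotomic) (h : G.HasEdgeOfWeight 3) : 1.556 ≤ G.mahlerMeasure := by
  obtain ⟨i, j, hadj, hw⟩ := h
  have hij := hadj.1
  have hn : Complex.normSq (G.matrix i j) = 3 := by
    simpa using normSq_of_mem_labelsOfNorm hw
  by_contra hM
  rw [not_le] at hM
  refine hG ?_
  obtain ⟨hi, hj⟩ | ⟨hi, hj⟩ | ⟨hi, hj⟩ := charge_of_normSq_eq_three hM hij hn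
  · exact isCyclotomic_of_neutral hd hconn hM hij hn hi hj
  · exact isCyclotomic_of_charged hconn hM hij hn hi hj
  · exact isCyclotomic_of_charged hconn hM hij.symm (by rw [G.normSq_comm, hn]) hj hi

end LGraph

end LGraphs

theorem mainTheorem10 (d : ℤ) (hd : d < 0) (hsq : Squarefree d) (hd1 : d ≠ -1) (hd3 : d ≠ -3)
    {V : Type*} [Fintype V] [DecidableEq V] (G : LGraphs.LGraph d V)
    (hconn : G.Connected) (hG : ¬ G.IsCyclotomic) :
    (G.HasEdgeOfWeight 4 → 2.08 ≤ G.mahlerMeasure ∧ 1.3 < G.mahlerMeasure) ∧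
    (G.HasEdgeOfWeight 3 → 1.556 ≤ G.mahlerMeasure ∧ 1.3 < G.mahlerMeasure) ∧
    (G.mahlerMeasure ≤ 1.3 → G.IsLPrimeGraph) := by
  have h4 := LGraphs.LGraph.le_mahlerMeasure_of_hasEdgeOfWeight_four hd hconn hG
  have h3 := LGraphs.LGraph.le_mahlerMeasure_of_hasEdgeOfWeight_three hd hconn hG
  refine ⟨fun h => ⟨h4 h, lt_of_lt_of_le (by norm_num) (h4 h)⟩,
    fun h => ⟨h3 h, lt_of_lt_of_le (by norm_num) (h3 h)⟩, fun hM => ?_⟩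
  refine LGraphs.LGraph.isLPrimeGraph_of_not_hasEdgeOfWeight (fun h => ?_) fun h => ?_
  · have := (h3 h).trans hM
    norm_num at this
  · have := (h4 h).trans hM
    norm_num at this
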